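/- Let $A^+$ be a Noetherian commutative ring and let $A = S^{-1}A^+$ be a localisation of $A^+$ such that $A^+\to A$ is injective. Let $N\subseteq A$ be a finitely generated $A^+$-submodule with $A^+\subseteq N$, and let $t\in A^+$ be a nonzerodivisor with $tN\subseteq A^+$. For an ideal $T\subseteq A^+$ let $f_T:\mathrm{Proj}\bigl(\bigoplus_{n\ge 0}T^n\bigr)\to\mathrm{Spec}\,A^+$ denote the blow-up along $T$, and for an $A^+$-submodule $L\subseteq A$ let $f_T^{-1}L$ denote the image of $f_T^*\widetilde L\to f_T^*\widetilde A$. Then the following are equivalent: 1. $A^+\subseteq N$ is an integral extension relative to $Z=V(t)$, i.e. there is a finitely generated ideal $T\subseteq A^+$ with $V(T)\subseteq V(t)$ such that $f_T^{-1}A^+=f_T^{-1}N$ as subsheaves of $f_T^*\widetilde A$; 2. there is an $A^+$-subalgebra $B\subseteq A$, finite as an $A^+$-module, with $N\subseteq B$. -/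

import Mathlib

open AlgebraicGeometry CategoryTheory Polynomial

universe u

noncomputable section

/-- The degree `n` part `Tⁿ tⁿ` of the Rees algebra `R[Tt] = ⨁ₙ Tⁿ tⁿ ⊆ R[t]` of an ideal `T`. -/
def reesGrading {R : Type u} [CommRing R] (T : Ideal R) (n : ℕ) :
    Submodule R (reesAlgebra T) :=
  (LinearMap.range (Polynomial.monomial (R := R) n)).comap (reesAlgebra T).val.toLinearMap

theorem mem_reesGrading {R : Type u} [CommRing R] {T : Ideal R} {n : ℕ} {f : reesAlgebra T} :
    f ∈ reesGrading T n ↔ ∃ r : R, Polynomial.monomial n r = (f : R[X]) :=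
  Iff.rfl

/-- The homogeneous component of degree `n` of an element of the Rees algebra. -/
def reesComponent {R : Type u} [CommRing R] {T : Ideal R} (f : reesAlgebra T) (n : ℕ) :
    reesGrading T n :=
  ⟨⟨Polynomial.monomial n ((f : R[X]).coeff n), reesAlgebra.monomial_mem.2 (f.2 n)⟩, ⟨_, rfl⟩⟩

instance reesGrading.gradedMonoid {R : Type u} [CommRing R] (T : Ideal R) :
    SetLike.GradedMonoid (reesGrading T) where
  one_mem := ⟨1, rfl⟩
  mul_mem := by
    rintro i j f g ⟨r, hr⟩ ⟨s, hs⟩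
    refine ⟨r * s, ?_⟩
    have hr' : Polynomial.monomial i r = (f : R[X]) := hr
    have hs' : Polynomial.monomial j s = (g : R[X]) := hs
    rw [← Polynomial.monomial_mul_monomial, hr', hs']
    rfl

instance reesGrading.decomposition {R : Type u} [CommRing R] (T : Ideal R) :
    DirectSum.Decomposition (reesGrading T) :=
  haveI : DirectSum.IsInternal (reesGrading T) := by
    classical
    constructor
    · intro x x' hx
      have key : ∀ (y : DirectSum ℕ fun i => reesGrading T i) (n : ℕ),
          Polynomial.monomial n
            (((DirectSum.coeAddMonoidHom (reesGrading T) y : reesAlgebra T) : R[X]).coeff n) =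
            ((y n : reesAlgebra T) : R[X]) := by
        intro y n
        induction y using DirectSum.induction_on with
        | zero => simp
        | of i z =>
          obtain ⟨z, r, hr⟩ := z
          have hr' : Polynomial.monomial i r = (z : R[X]) := hr
          rw [DirectSum.coeAddMonoidHom_of]
          by_cases h : i = n
          · subst h
            simp [DirectSum.of_eq_same, ← hr']
          · rw [DirectSum.of_eq_of_ne _ _ _ (Ne.symm h)]
            simp [← hr', Polynomial.coeff_monomial, h]
        | add a b ha hb =>
          simp only [map_add, DirectSum.add_apply, Submodule.coe_add, Subalgebra.coe_add,
            Polynomial.coeff_add, ha, hb]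
      refine DFinsupp.ext fun n => Subtype.ext (Subtype.ext ?_)
      rw [← key x n, ← key x' n, hx]
    · intro f
      refine ⟨∑ n ∈ (f : R[X]).support, DirectSum.of (fun i => reesGrading T i) n
        (reesComponent f n), ?_⟩
      rw [map_sum]
      simp only [DirectSum.coeAddMonoidHom_of]
      refine Subtype.ext ?_
      rw [AddSubmonoidClass.coe_finsetSum]
      exact (Polynomial.as_sum_support (f : R[X])).symm
  this.chooseDecomposition

instance reesGrading.gradedAlgebra {R : Type u} [CommRing R] (T : Ideal R) :
    GradedAlgebra (reesGrading T) where

/-- The blow-up `Proj (⨁ₙ Tⁿ)` of `Spec R` along the ideal `T`. -/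
def blowUp {R : Type u} [CommRing R] (T : Ideal R) : Scheme.{u} :=
  Proj (reesGrading T)

/-- The structure morphism of the blow-up of `Spec R` along `T`: the canonical morphism
`Proj 𝒜 ⟶ Spec 𝒜₀`, followed by `Spec 𝒜₀ ⟶ Spec R`. -/
def blowUpToSpec {R : Type u} [CommRing R] (T : Ideal R) :
    blowUp T ⟶ Spec (CommRingCat.of R) :=
  Proj.toSpecZero (reesGrading T) ≫
    Spec.map (CommRingCat.ofHom (algebraMap R (reesGrading T 0)))

/-- The inverse image `f⁻¹N` of a submodule `N ⊆ M` along a morphism `f : Y ⟶ Spec R`: the image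
of `f^*Ñ ⟶ f^*M̃`, as a subobject of the sheaf of modules `f^*M̃` on `Y`. -/
def inverseImage {R : Type u} [CommRing R] {M : Type u} [AddCommGroup M] [Module R M]
    {Y : Scheme.{u}} (f : Y ⟶ Spec (CommRingCat.of R)) (N : Submodule R M) :
    Subobject ((Scheme.Modules.pullback f).obj
      (tilde (R := CommRingCat.of R) (ModuleCat.of R M))) :=
  Limits.imageSubobject ((Scheme.Modules.pullback f).map
    (tilde.map (R := CommRingCat.of R) (ModuleCat.ofHom N.subtype)))

/-- `N₁ ⊆ N₂` is an integral extension of submodules of `M` relative to the closed subset `Z` of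
`Spec R`: there is a blow-up of `Spec R` along a finitely generated ideal, cosupported
set-theoretically in `Z`, on which the inverse images of `N₁` and `N₂` are equal. -/
def IsIntegralExtension {R : Type u} [CommRing R] {M : Type u} [AddCommGroup M] [Module R M]
    (Z : Set (PrimeSpectrum R)) (N₁ N₂ : Submodule R M) : Prop :=
  N₁ ≤ N₂ ∧ ∃ T : Ideal R, T.FG ∧ PrimeSpectrum.zeroLocus (T : Set R) ⊆ Z ∧
    inverseImage (blowUpToSpec T) N₁ = inverseImage (blowUpToSpec T) N₂

end

open AlgebraicGeometry CategoryTheory Polynomial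

noncomputable section

/-! Write R for A⁺. Both directions reduce to commutative algebra on the charts Spec R[T/a], a ∈ T,
of the blow-up. If f⁻¹N ⊆ f⁻¹R, each n ∈ N comes from R[T/a] inside A[1/a], so aᵏn ∈ Tᵏ for some k.
As N and T are finitely generated, one exponent gives N·Tᵏ ⊆ Tᵏ. So N lies in the multiplier ring
(Tᵏ : Tᵏ) ⊆ A, which is finite over R because Tᵏ contains a power of the regular element t.
Conversely, given B, let T be the conductor of D = R[N] ⊆ B into R. It contains a power of t and
satisfies T·N ⊆ T, so n = (an)/a lies in R[T/a] on every chart. Sheaf images are compared by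
adjunction (`inverseImage_le_iff`): an inclusion is tested on linear maps into global sections.
`exists_pow_smul_eq_of_inverseImage_blowUp_le_one` and `inverseImage_blowUp_le_one` translate it
into algebra. -/

theorem CategoryTheory.Limits.imageSubobject_le_imageSubobject_iff {C : Type*} [Category C]
    [Abelian C] {X X' Y : C} (f : X ⟶ Y) (g : X' ⟶ Y) :
    imageSubobject f ≤ imageSubobject g ↔ ∀ (Z : C) (q : Y ⟶ Z), g ≫ q = 0 → f ≫ q = 0 := by
  constructor
  · intro h Z q hq
    rw [← imageSubobject_arrow_comp f, ← Subobject.ofLE_arrow h, Category.assoc, Category.assoc,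
      imageSubobject_arrow_comp_eq_zero hq, Limits.comp_zero, Limits.comp_zero]
  · intro h
    -- The image of `g` is the kernel of its cokernel, so the cokernel is the only test map needed.
    have e := (ShortComplex.exact_iff_image_eq_kernel _).1 (ShortComplex.exact_cokernel g)
    dsimp at e
    rw [e]
    exact image_le_kernel _ _ (h _ _ (Limits.cokernel.condition g))

/-! ### Inverse images via the adjunction with global sections -/

section

variable {R : Type u} [CommRing R] {Y : Scheme.{u}} (f : Y ⟶ Spec (CommRingCat.of R))

/-- The global sections of a sheaf of modules on `Y`, as a module over `R`. -/
def globalSectionsFunctor : Y.Modules ⥤ ModuleCat.{u} R :=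
  Scheme.Modules.pushforward f ⋙ moduleSpecΓFunctor (R := CommRingCat.of R)

/-- The functor `M ↦ f^*M̃` is left adjoint to taking global sections. -/
def pullbackTildeAdjunction :
    tilde.functor (CommRingCat.of R) ⋙ Scheme.Modules.pullback f ⊣ globalSectionsFunctor f :=
  (tilde.adjunction (R := CommRingCat.of R)).comp (Scheme.Modules.pullbackPushforwardAdjunction f)

/-- The `R`-module of global sections of `G`, compared with the group of sections over `⊤`. -/
def globalSectionsEquiv (G : Y.Modules) :
    ((globalSectionsFunctor f).obj G : ModuleCat R) ≃+ Γ(G, ⊤) :=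
  AddEquiv.refl Γ(G, ⊤)

theorem globalSectionsEquiv_smul {G : Y.Modules} (r : R) (x : (globalSectionsFunctor f).obj G) :
    globalSectionsEquiv f G (r • x) =
      (show Γ(Y, ⊤) from f.app ⊤ ((Scheme.ΓSpecIso (CommRingCat.of R)).inv r)) •
        globalSectionsEquiv f G x := by
  have := Scheme.Modules.smul_Spec_def (M := (Scheme.Modules.pushforward f).obj G) (U := ⊤) r x
  have h2 : (Spec (CommRingCat.of R)).presheaf.map (TopologicalSpace.Opens.leTop ⊤).op = 𝟙 _ :=
    (Spec (CommRingCat.of R)).presheaf.map_id _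
  rw [h2] at this
  exact this

/-- The sheaf `f^*M̃`. -/
abbrev pullbackTilde (M : Type u) [AddCommGroup M] [Module R M] : Y.Modules :=
  (Scheme.Modules.pullback f).obj (tilde (R := CommRingCat.of R) (ModuleCat.of R M))

/-- Morphisms `f^*M̃ ⟶ G` correspond to linear maps from `M` to the global sections of `G`. -/
def pullbackTildeHomEquiv (M : Type u) [AddCommGroup M] [Module R M] (G : Y.Modules) :
    (pullbackTilde f M ⟶ G) ≃ (M →ₗ[R] (globalSectionsFunctor f).obj G) :=
  ((pullbackTildeAdjunction f).homEquiv (ModuleCat.of R M) G).trans ModuleCat.homEquiv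

variable {f} {M : Type u} [AddCommGroup M] [Module R M] {G G' : Y.Modules}

theorem pullbackTildeHomEquiv_map_comp {M' : Type u} [AddCommGroup M'] [Module R M']
    (g : M' →ₗ[R] M) (q : pullbackTilde f M ⟶ G) :
    pullbackTildeHomEquiv f M' G ((Scheme.Modules.pullback f).map
      (tilde.map (R := CommRingCat.of R) (ModuleCat.ofHom g)) ≫ q) =
      pullbackTildeHomEquiv f M G q ∘ₗ g := by
  have := (pullbackTildeAdjunction f).homEquiv_naturality_left (ModuleCat.ofHom g) q
  exact congr_arg ModuleCat.Hom.hom this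

theorem pullbackTildeHomEquiv_comp (q : pullbackTilde f M ⟶ G) (h : G ⟶ G') (m : M) :
    globalSectionsEquiv f G' (pullbackTildeHomEquiv f M G' (q ≫ h) m) =
      h.app ⊤ (globalSectionsEquiv f G (pullbackTildeHomEquiv f M G q m)) := by
  have := (pullbackTildeAdjunction f).homEquiv_naturality_right q h
  exact congr_arg (fun k => ModuleCat.Hom.hom k m) this

theorem pullbackTildeHomEquiv_zero :
    pullbackTildeHomEquiv f M G 0 = 0 := by
  ext m
  have := pullbackTildeHomEquiv_comp (0 : pullbackTilde f M ⟶ G) (0 : G ⟶ G) m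
  rw [Limits.comp_zero] at this
  exact (globalSectionsEquiv f G).injective (this.trans (map_zero (globalSectionsEquiv f G)).symm)

theorem inverseImage_le_iff (N₁ N₂ : Submodule R M) :
    inverseImage f N₁ ≤ inverseImage f N₂ ↔
      ∀ (G : Y.Modules) (q : pullbackTilde f M ⟶ G),
        N₂ ≤ LinearMap.ker (pullbackTildeHomEquiv f M G q) →
          N₁ ≤ LinearMap.ker (pullbackTildeHomEquiv f M G q) := by
  have key (N : Submodule R M) (G : Y.Modules) (q : pullbackTilde f M ⟶ G) :
      (Scheme.Modules.pullback f).map (tilde.map (R := CommRingCat.of R)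
        (ModuleCat.ofHom N.subtype)) ≫ q = 0 ↔
        N ≤ LinearMap.ker (pullbackTildeHomEquiv f M G q) := by
    rw [← (pullbackTildeHomEquiv f N G).apply_eq_iff_eq, pullbackTildeHomEquiv_map_comp,
      pullbackTildeHomEquiv_zero]
    exact ⟨fun h n hn => LinearMap.congr_fun h ⟨n, hn⟩, fun h => LinearMap.ext fun n => h n.2⟩
  simp only [← key]
  exact Limits.imageSubobject_le_imageSubobject_iff _ _

theorem inverseImage_mono {N₁ N₂ : Submodule R M} (h : N₁ ≤ N₂) :
    inverseImage f N₁ ≤ inverseImage f N₂ :=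
  (inverseImage_le_iff _ _).2 fun _ _ h' => h.trans h'

end

/-! ### Testing inverse images on charts -/

section
variable {R : Type u} [CommRing R] {Y : Scheme.{u}} {f : Y ⟶ Spec (CommRingCat.of R)}

/-- A semilinear map out of `M` over a chart of `Y` detects inclusions of inverse images. -/
theorem le_ker_of_inverseImage_le {C : Type u} [CommRing C] {φ : R →+* C}
    (j : Spec (CommRingCat.of C) ⟶ Y) (hj : j ≫ f = Spec.map (CommRingCat.ofHom φ))
    {M : Type u} [AddCommGroup M] [Module R M] {N₁ N₂ : Submodule R M}
    (h : inverseImage f N₁ ≤ inverseImage f N₂) {K : Type u} [AddCommGroup K] [Module C K]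
    (ρ : M →ₛₗ[φ] K) (h₂ : N₂ ≤ LinearMap.ker ρ) : N₁ ≤ LinearMap.ker ρ := by
  -- The test sheaf is `j_*K̃`: its global sections are `K`, so by adjunction `ρ` becomes a morphism
  -- out of `f^*M̃`.
  let G : Y.Modules := (Scheme.Modules.pushforward j).obj
    (tilde (R := CommRingCat.of C) (ModuleCat.of C K))
  let e' := (tilde.isoTop (R := CommRingCat.of C) (ModuleCat.of C K)).toLinearEquiv
  let e : K ≃+ Γ(G, ⊤) := e'.toAddEquiv
  have hsmul (r : R) (x : K) : e (φ r • x) =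
      (show Γ(Y, ⊤) from f.app ⊤ ((Scheme.ΓSpecIso (CommRingCat.of R)).inv r)) •
        e x := by
    refine (e'.map_smul (φ r) x).trans ?_
    have h1 : (Scheme.ΓSpecIso (CommRingCat.of C)).inv (φ r) =
        (j.app ⊤ (f.app ⊤ ((Scheme.ΓSpecIso (CommRingCat.of R)).inv r))) := by
      have h3 := Scheme.ΓSpecIso_inv_naturality (CommRingCat.ofHom φ)
      rw [← hj] at h3
      exact congr($h3 r)
    have h2 := Scheme.Modules.smul_Spec_def (U := ⊤)
      (M := tilde (R := CommRingCat.of C) (ModuleCat.of C K)) (φ r) (e' x)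
    have h4 : (Spec (CommRingCat.of C)).presheaf.map (TopologicalSpace.Opens.leTop ⊤).op = 𝟙 _ :=
      (Spec (CommRingCat.of C)).presheaf.map_id _
    rw [h4, CategoryTheory.id_apply, h1] at h2
    exact h2
  let b : M →ₗ[R] (globalSectionsFunctor f).obj G :=
    { toFun m := (globalSectionsEquiv f G).symm (e (ρ m))
      map_add' x y := by simp
      map_smul' r x := by
        apply (globalSectionsEquiv f G).injective
        rw [RingHom.id_apply, globalSectionsEquiv_smul, map_smulₛₗ, hsmul]
        simp }
  have hb (m : M) : b m = 0 ↔ ρ m = 0 := by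
    change (globalSectionsEquiv f G).symm (e (ρ m)) = 0 ↔ _
    rw [EmbeddingLike.map_eq_zero_iff, EmbeddingLike.map_eq_zero_iff]
  have := (inverseImage_le_iff N₁ N₂).1 h G ((pullbackTildeHomEquiv f M G).symm b)
  rw [Equiv.apply_symm_apply] at this
  exact fun n hn => (hb n).1 (this (fun m hm => (hb m).2 (h₂ hm)) hn)

/-- Elements of `S` act invertibly on `A`, hence on `f^*Ã`. On each chart `s·n = r·1 = s·(c·1)`, and
cancelling `s` gives `n = c·1`; a morphism killing `1` therefore kills `n` locally, hence globally.
-/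
theorem inverseImage_le_one_of_cover {A : Type u} [CommRing A] [Algebra R A] (S : Submonoid R)
    [IsLocalization S A] {ι : Type*} (C : ι → Type u) [∀ i, CommRing (C i)]
    (j : ∀ i, Spec (CommRingCat.of (C i)) ⟶ Y) [∀ i, IsOpenImmersion (j i)]
    (hcov : ⨆ i, (j i).opensRange = ⊤) (φ : ∀ i, R →+* C i)
    (hj : ∀ i, j i ≫ f = Spec.map (CommRingCat.ofHom (φ i))) (N : Submodule R A)
    (hN : ∀ n ∈ N, ∀ i, ∃ s ∈ S, ∃ (r : R) (c : C i), s • n = algebraMap R A r ∧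
      φ i r = φ i s * c) :
    inverseImage f N ≤ inverseImage f (1 : Submodule R A) := by
  rw [inverseImage_le_iff]
  intro G q h1 n hn
  let F := pullbackTilde f A
  let s (a : A) : Γ(F, ⊤) := globalSectionsEquiv f F (pullbackTildeHomEquiv f A F (𝟙 _) a)
  have hq (a : A) : globalSectionsEquiv f G (pullbackTildeHomEquiv f A G q a) = q.app ⊤ (s a) := by
    rw [← pullbackTildeHomEquiv_comp, Category.id_comp]
  rw [LinearMap.mem_ker, ← (globalSectionsEquiv f G).map_eq_zero_iff, hq]
  refine TopCat.Sheaf.eq_of_locally_eq' ⟨_, G.isSheaf⟩ (fun i => j i ''ᵁ ⊤) ⊤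
    (fun i => homOfLE le_top) ?_ _ _ fun i => ?_
  · simp only [Scheme.Hom.image_top_eq_opensRange]
    exact hcov.ge
  obtain ⟨σ, hσ, r, c, hr, hc⟩ := hN n hn i
  let U := j i ''ᵁ ⊤
  let ρ (r : R) : Γ(Y, ⊤) := f.app ⊤ ((Scheme.ΓSpecIso (CommRingCat.of R)).inv r)
  let γ (c : C i) : Γ(Y, U) := ((j i).appIso ⊤).inv ((Scheme.ΓSpecIso (CommRingCat.of (C i))).inv c)
  have hγ (c c' : C i) : γ (c * c') = γ c * γ c' := by simp only [γ, map_mul]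
  have hργ (r : R) : Y.presheaf.map (homOfLE (le_top : U ≤ ⊤)).op (ρ r) = γ (φ i r) := by
    have h3 := Scheme.ΓSpecIso_inv_naturality (CommRingCat.ofHom (φ i))
    have h4 : (Spec.map (CommRingCat.ofHom (φ i))).appTop = f.appTop ≫ (j i).appTop := by
      rw [← hj, Scheme.Hom.comp_appTop]
    have h5 : (Scheme.ΓSpecIso (CommRingCat.of R)).inv ≫ f.appTop ≫
        Y.presheaf.map (homOfLE (le_top : U ≤ ⊤)).op =
        CommRingCat.ofHom (φ i) ≫ (Scheme.ΓSpecIso (CommRingCat.of (C i))).inv ≫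
          ((j i).appIso ⊤).inv := by
      have h6 := (j i).app_appIso_inv ⊤
      rw [reassoc_of% h3, h4, Category.assoc]
      exact congr((Scheme.ΓSpecIso (CommRingCat.of R)).inv ≫ f.appTop ≫ $h6.symm)
    exact congr($h5 r)
  have hs (r : R) (a : A) : s (r • a) = ρ r • s a := by
    simp only [s, map_smul, globalSectionsEquiv_smul, ρ]
  let μ : F ⟶ F := (Scheme.Modules.pullback f).map (tilde.map (R := CommRingCat.of R)
    (ModuleCat.ofHom (LinearMap.lsmul R A σ)))
  have : IsIso μ := by
    have hu : IsIso (ModuleCat.ofHom (LinearMap.lsmul R A σ)) := by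
      rw [ConcreteCategory.isIso_iff_bijective]
      exact (Module.End.isUnit_iff _).1
        (IsLocalizedModule.map_units (S := S) (Algebra.linearMap R A) ⟨σ, hσ⟩)
    have : IsIso (tilde.map (R := CommRingCat.of R) (ModuleCat.ofHom (LinearMap.lsmul R A σ))) :=
      Functor.map_isIso (tilde.functor (CommRingCat.of R)) _
    exact Functor.map_isIso _ _
  have hμ (a : A) : μ.app ⊤ (s a) = s (σ • a) := by
    have h2 := pullbackTildeHomEquiv_map_comp (f := f) (LinearMap.lsmul R A σ) (𝟙 F)
    rw [Category.comp_id, ← Category.id_comp ((Scheme.Modules.pullback f).map _)] at h2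
    rw [← pullbackTildeHomEquiv_comp]
    exact congr(globalSectionsEquiv f F ($h2 a))
  let res (H : Y.Modules) : Γ(H, ⊤) ⟶ Γ(H, U) := H.presheaf.map (homOfLE (le_top : U ≤ ⊤)).op
  have hres {H H' : Y.Modules} (p : H ⟶ H') (x : Γ(H, ⊤)) :
      p.app U (res H x) = res H' (p.app ⊤ x) := by
    exact congr($(p.mapPresheaf.naturality (homOfLE (le_top : U ≤ ⊤)).op) x)
  have hmain : res F (s n) = γ c • res F (s 1) := by
    have hinj : Function.Injective (μ.app U) :=
      (ConcreteCategory.isIso_iff_bijective (μ.app U)).1 inferInstance |>.1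
    apply hinj
    rw [Scheme.Modules.Hom.app_smul, hres, hres, hμ, hμ, hr, Algebra.algebraMap_eq_smul_one, hs, hs]
    simp only [res, Scheme.Modules.map_smul, hργ, smul_smul, hc]
    rw [hγ, mul_comm]
  have h1' : q.app ⊤ (s 1) = 0 := by
    rw [← hq, LinearMap.mem_ker.1 (h1 (Submodule.one_le.1 le_rfl)), map_zero]
  have : res G (q.app ⊤ (s n)) = 0 := by
    rw [← hres, hmain, Scheme.Modules.Hom.app_smul, hres, h1', map_zero, smul_zero]
  exact this.trans (map_zero (res G).hom).symm
/-- Over a chart `Spec C` of `Y`, an element of `N` lies in the image of `C` as soon as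
`f⁻¹N ⊆ f⁻¹R`. -/
theorem mem_range_of_inverseImage_le_one {C A D : Type u} [CommRing C] [CommRing A] [CommRing D]
    [Algebra R A] {φ : R →+* C} (j : Spec (CommRingCat.of C) ⟶ Y)
    (hj : j ≫ f = Spec.map (CommRingCat.ofHom φ)) {N : Submodule R A}
    (h : inverseImage f N ≤ inverseImage f (1 : Submodule R A)) (ψ : C →+* D) (θ : A →+* D)
    (hψ : ∀ r, ψ (φ r) = θ (algebraMap R A r)) {n : A} (hn : n ∈ N) : θ n ∈ ψ.range := by
  algebraize [ψ]
  -- Modulo the image of `C`, the map `θ` kills `1`, so it must kill `N`.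
  let ρ : A →ₛₗ[φ] D ⧸ LinearMap.range (Algebra.linearMap C D) :=
    { toFun a := Submodule.Quotient.mk (θ a)
      map_add' a b := by rw [map_add, Submodule.Quotient.mk_add]
      map_smul' r a := by
        rw [Algebra.smul_def, map_mul, ← hψ, ← Submodule.Quotient.mk_smul, Algebra.smul_def]
        rfl }
  have hρ (a : A) : a ∈ LinearMap.ker ρ ↔ θ a ∈ ψ.range :=
    Submodule.Quotient.mk_eq_zero _
  refine (hρ n).1 (le_ker_of_inverseImage_le j hj h ρ ?_ hn)
  rw [Submodule.one_le, hρ, map_one]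
  exact one_mem _

end

/-! ### Charts of the blow-up -/

section
variable {R : Type u} [CommRing R] {T : Ideal R}

/-- An element `a` of `T`, regarded as an element `a t` of degree one of the Rees algebra. -/
def reesDegreeOne (a : T) : reesAlgebra T :=
  ⟨Polynomial.monomial 1 a.1, reesAlgebra.monomial_mem.2 (by simp)⟩

theorem reesDegreeOne_mem (a : T) : reesDegreeOne a ∈ reesGrading T 1 :=
  ⟨a.1, rfl⟩

theorem exists_monomial_eq_of_mem_reesGrading {f : reesAlgebra T} {n : ℕ}
    (hf : f ∈ reesGrading T n) : ∃ r ∈ T ^ n, Polynomial.monomial n r = (f : R[X]) := by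
  obtain ⟨r, hr⟩ := mem_reesGrading.1 hf
  have := f.2 n
  rw [← hr, Polynomial.coeff_monomial_same] at this
  exact ⟨r, this, hr⟩

/-- Since `Tⁿ⁺¹ = Tⁿ·T`, positive degrees are generated by degree one; this makes the charts at `a ∈
T` cover. -/
theorem irrelevant_le_span_reesDegreeOne :
    (HomogeneousIdeal.irrelevant (reesGrading T)).toIdeal ≤
      Ideal.span (Set.range (reesDegreeOne (T := T))) := by
  have key (n : ℕ) (r : R) (hr : r ∈ T ^ (n + 1)) :
      (⟨Polynomial.monomial (n + 1) r, reesAlgebra.monomial_mem.2 hr⟩ : reesAlgebra T) ∈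
        Ideal.span (Set.range (reesDegreeOne (T := T))) := by
    have hr' := hr
    rw [pow_succ] at hr'
    induction hr' using Submodule.mul_induction_on' with
    | mem_mul_mem b hb a ha =>
      have e : (⟨Polynomial.monomial (n + 1) (b * a), reesAlgebra.monomial_mem.2 hr⟩ :
          reesAlgebra T) =
          ⟨Polynomial.monomial n b, reesAlgebra.monomial_mem.2 hb⟩ * reesDegreeOne ⟨a, ha⟩ :=
        Subtype.ext (Polynomial.monomial_mul_monomial n 1 b a).symm
      rw [e]
      exact Ideal.mul_mem_left _ _ (Ideal.subset_span ⟨_, rfl⟩)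
    | add x hx y hy hx' hy' =>
      have e : (⟨Polynomial.monomial (n + 1) (x + y), reesAlgebra.monomial_mem.2 hr⟩ :
          reesAlgebra T) =
          ⟨Polynomial.monomial (n + 1) x, reesAlgebra.monomial_mem.2 (by rwa [pow_succ])⟩ +
          ⟨Polynomial.monomial (n + 1) y, reesAlgebra.monomial_mem.2 (by rwa [pow_succ])⟩ :=
        Subtype.ext (map_add _ x y)
      rw [e]
      exact add_mem (hx' (by rwa [pow_succ])) (hy' (by rwa [pow_succ]))
  intro x hx
  classical
  rw [← DirectSum.sum_support_decompose (reesGrading T) x]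
  refine Ideal.sum_mem _ fun i _ => ?_
  rcases i with - | n
  · have h0 := (HomogeneousIdeal.mem_irrelevant_iff (reesGrading T) x).1 hx
    rw [GradedRing.proj_apply] at h0
    rw [h0]
    exact zero_mem _
  · obtain ⟨r, hrT, hr⟩ := exists_monomial_eq_of_mem_reesGrading
      (DirectSum.decompose (reesGrading T) x (n + 1)).2
    rw [← show _ = (DirectSum.decompose (reesGrading T) x (n + 1) : reesAlgebra T) from
      Subtype.ext (a1 := ⟨_, reesAlgebra.monomial_mem.2 hrT⟩) hr]
    exact key n r hrT

/-- The coordinate ring `R[T/a]` of the chart of the blow-up along `T` given by `a`. -/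
abbrev blowUpChartRing (a : T) : Type u :=
  HomogeneousLocalization.Away (reesGrading T) (reesDegreeOne a)

/-- The structure map of the `R`-algebra `R[T/a]`. -/
def toBlowUpChartRing (a : T) : R →+* blowUpChartRing a :=
  (HomogeneousLocalization.fromZeroRingHom (reesGrading T) _).comp
    (algebraMap R (reesGrading T 0))

theorem val_toBlowUpChartRing (a : T) (r : R) :
    (toBlowUpChartRing a r).val = algebraMap (reesAlgebra T) _ (algebraMap R (reesAlgebra T) r) :=
  Localization.mk_one_eq_algebraMap (M := Submonoid.powers (reesDegreeOne a)) _

/-- The chart of the blow-up along `T` given by `a`. -/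
def blowUpChart (a : T) : Spec (CommRingCat.of (blowUpChartRing a)) ⟶ blowUp T :=
  Proj.awayι (reesGrading T) (reesDegreeOne a) (reesDegreeOne_mem a) one_pos

instance (a : T) : IsOpenImmersion (blowUpChart a) :=
  inferInstanceAs (IsOpenImmersion (Proj.awayι ..))

theorem blowUpChart_toSpec (a : T) :
    blowUpChart a ≫ blowUpToSpec T = Spec.map (CommRingCat.ofHom (toBlowUpChartRing a)) := by
  refine (Proj.awayι_toSpecZero_assoc ..).trans ?_
  rw [← Spec.map_comp]
  rfl

theorem iSup_opensRange_blowUpChart : ⨆ a : T, (blowUpChart a).opensRange = ⊤ := by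
  refine Eq.trans ?_ (Proj.iSup_basicOpen_eq_top (reesGrading T) _ irrelevant_le_span_reesDegreeOne)
  exact iSup_congr fun a => Proj.opensRange_awayι ..

variable {A : Type u} [CommRing A] [Algebra R A]

theorem inverseImage_blowUp_le_one (S : Submonoid R) [IsLocalization S A]
    (hinj : Function.Injective (algebraMap R A)) {N : Submodule R A}
    (hN : ∀ n ∈ N, ∀ a ∈ T, ∃ x ∈ T, a • n = algebraMap R A x) :
    inverseImage (blowUpToSpec T) N ≤ inverseImage (blowUpToSpec T) (1 : Submodule R A) := by
  refine inverseImage_le_one_of_cover S (fun a : T => blowUpChartRing a) blowUpChart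
    iSup_opensRange_blowUpChart toBlowUpChartRing blowUpChart_toSpec N fun n hn a => ?_
  obtain ⟨⟨r, s⟩, hrs⟩ := IsLocalization.surj S n
  obtain ⟨x, hx, hax⟩ := hN n hn a a.2
  have hr : (s : R) • n = algebraMap R A r := by rw [Algebra.smul_def, mul_comm, hrs]
  -- The local coefficient is the fraction `x/a`, where `x = a·n`.
  refine ⟨s, s.2, r, HomogeneousLocalization.Away.mk (reesGrading T) (reesDegreeOne_mem a) 1
    (reesDegreeOne ⟨x, hx⟩) (reesDegreeOne_mem _), hr, ?_⟩
  have hra : r * a = s * x := by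
    apply hinj
    rw [map_mul, map_mul, ← hr, ← hax]
    simp only [Algebra.smul_def]
    ring
  apply HomogeneousLocalization.val_injective
  rw [HomogeneousLocalization.val_mul, val_toBlowUpChartRing, val_toBlowUpChartRing,
    HomogeneousLocalization.Away.val_mk, Localization.mk_eq_mk', IsLocalization.mul_mk'_eq_mk'_of_mul,
    IsLocalization.eq_mk'_iff_mul_eq, ← map_mul]
  congr 1
  apply Subtype.ext
  simp [reesDegreeOne, Polynomial.algebraMap_eq, Polynomial.C_mul_monomial, hra]

theorem exists_pow_smul_eq_of_inverseImage_blowUp_le_one {N : Submodule R A}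
    (h : inverseImage (blowUpToSpec T) N ≤ inverseImage (blowUpToSpec T) (1 : Submodule R A))
    {n : A} (hn : n ∈ N) {a : R} (ha : a ∈ T) :
    ∃ k, ∃ x ∈ T ^ k, a ^ k • n = algebraMap R A x := by
  let D := Localization.Away (algebraMap R A a)
  -- Setting the Rees variable to `1` sends the degree-one element of `a` to the unit `a` of
  -- `A[1/a]`, which maps the chart ring there.
  let ev : reesAlgebra T →+* D := (algebraMap A D).comp ((algebraMap R A).comp
    ((Polynomial.evalRingHom 1).comp (reesAlgebra T).val.toRingHom))
  have hev : ev (reesDegreeOne ⟨a, ha⟩) = algebraMap A D (algebraMap R A a) := by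
    simp [ev, reesDegreeOne]
  have hu : IsUnit (ev (reesDegreeOne ⟨a, ha⟩)) := by
    rw [hev]; exact IsLocalization.Away.algebraMap_isUnit _
  let ψ : blowUpChartRing ⟨a, ha⟩ →+* D := (Localization.awayLift ev _ hu).comp
    (algebraMap (blowUpChartRing ⟨a, ha⟩) (Localization.Away (reesDegreeOne ⟨a, ha⟩)))
  obtain ⟨c, hc⟩ := mem_range_of_inverseImage_le_one (blowUpChart ⟨a, ha⟩) (blowUpChart_toSpec _) h
    ψ (algebraMap A D) (fun r => by
      change Localization.awayLift ev _ hu (toBlowUpChartRing _ r).val = _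
      rw [val_toBlowUpChartRing]
      simp [Localization.awayLift, ev]) hn
  obtain ⟨k, f, hf, rfl⟩ := HomogeneousLocalization.Away.mk_surjective (reesGrading T)
    (reesDegreeOne_mem ⟨a, ha⟩) c
  rw [smul_eq_mul, mul_one] at hf
  obtain ⟨r, hrT, hr⟩ := exists_monomial_eq_of_mem_reesGrading hf
  have e1 : algebraMap A D n * algebraMap A D (algebraMap R A a) ^ k =
      algebraMap A D (algebraMap R A r) := by
    let δ : Submonoid.powers (reesDegreeOne ⟨a, ha⟩) := ⟨reesDegreeOne ⟨a, ha⟩ ^ k, k, rfl⟩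
    have e2 : Localization.mk f δ *
        algebraMap _ (Localization.Away (reesDegreeOne ⟨a, ha⟩)) (reesDegreeOne ⟨a, ha⟩ ^ k) =
        algebraMap _ _ f := by
      rw [Localization.mk_eq_mk']
      exact IsLocalization.mk'_spec _ f δ
    have e3 := congr(Localization.awayLift ev _ hu $e2)
    rw [map_mul] at e3
    simp only [Localization.awayLift, IsLocalization.Away.lift_eq] at e3
    rw [← hc, ← hev, ← map_pow]
    refine Eq.trans ?_ (e3.trans ?_)
    · congr 1
    · simp [ev, ← hr]
  rw [← map_pow, ← map_mul] at e1
  -- `a` may be a zero divisor, so returning from `A[1/a]` to `A` costs an extra factor `aˡ`.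
  obtain ⟨⟨_, l, rfl⟩, hl⟩ := IsLocalization.exists_of_eq
    (M := Submonoid.powers (algebraMap R A a)) e1
  refine ⟨l + k, a ^ l * r, pow_add T l k ▸ Ideal.mul_mem_mul (Ideal.pow_mem_pow ha l) hrT, ?_⟩
  rw [map_mul, map_pow, ← hl, Algebra.smul_def, map_pow]
  ring

end

/-! ### Uniform exponents, multiplier rings and conductors -/

section
variable {R A : Type u} [CommRing R] [CommRing A] [Algebra R A]

theorem IsLocalization.coeSubmodule_pow (I : Ideal R) (n : ℕ) :
    coeSubmodule A (I ^ n) = coeSubmodule A I ^ n := by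
  induction n with
  | zero => rw [pow_zero, pow_zero, Ideal.one_eq_top, coeSubmodule_top]
  | succ n ih => rw [pow_succ, pow_succ, coeSubmodule_mul, ih]

theorem Submodule.mul_natCast_le (I : Submodule R A) (n : ℕ) : I * (n : Submodule R A) ≤ I := by
  induction n with
  | zero => simp
  | succ n ih => rw [Nat.cast_succ, mul_add, mul_one]; exact sup_le ih le_rfl

/-- Pigeonhole in the binomial expansion of `(I + J)^(k+l)`: each term has `I`-exponent at least `k`
or `J`-exponent at least `l`. -/
theorem Submodule.exists_mul_sup_pow_le {N I J T : Submodule R A} (hI : I ≤ T) (hJ : J ≤ T)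
    (hNI : ∃ k, N * I ^ k ≤ T ^ k) (hNJ : ∃ k, N * J ^ k ≤ T ^ k) :
    ∃ k, N * (I ⊔ J) ^ k ≤ T ^ k := by
  obtain ⟨k, hk⟩ := hNI
  obtain ⟨l, hl⟩ := hNJ
  have aux {I J : Submodule R A} (hI : I ≤ T) (hJ : J ≤ T) {k : ℕ} (hk : N * I ^ k ≤ T ^ k)
      (m n : ℕ) (hm : k ≤ m) : N * (I ^ m * J ^ n) ≤ T ^ (m + n) := by
    obtain ⟨d, rfl⟩ := Nat.exists_eq_add_of_le hm
    calc N * (I ^ (k + d) * J ^ n) = (N * I ^ k) * (I ^ d * J ^ n) := by rw [pow_add]; ring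
      _ ≤ T ^ k * (T ^ d * T ^ n) := by gcongr
      _ = T ^ (k + d + n) := by ring
  refine ⟨k + l, ?_⟩
  rw [← Submodule.add_eq_sup, add_pow, Finset.mul_sum]
  refine Finset.sum_induction _ (· ≤ T ^ (k + l)) (fun _ _ => sup_le) bot_le fun m hm => ?_
  rw [← mul_assoc]
  refine (mul_natCast_le _ _).trans ?_
  obtain ⟨n, hn⟩ := Nat.exists_eq_add_of_le (Nat.lt_succ_iff.1 (Finset.mem_range.1 hm))
  rw [hn, Nat.add_sub_cancel_left]
  rcases le_total k m with h | h
  · exact aux hI hJ hk m n h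
  · rw [mul_comm (I ^ m), add_comm m n]
    exact aux hJ hI hl n m (by omega)

theorem exists_mul_coeSubmodule_pow_le {N : Submodule R A} (hN : N.FG) {T : Ideal R} (hT : T.FG)
    (h : ∀ n ∈ N, ∀ a ∈ T, ∃ k, ∃ x ∈ T ^ k, a ^ k • n = algebraMap R A x) :
    ∃ k, N * IsLocalization.coeSubmodule A T ^ k ≤ IsLocalization.coeSubmodule A T ^ k := by
  -- The target stays `Tᵏ` while `I` grows from principal ideals to `T`.
  suffices H : ∀ I : Ideal R, I.FG → I ≤ T → ∃ k, N * IsLocalization.coeSubmodule A I ^ k ≤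
      IsLocalization.coeSubmodule A T ^ k from H T hT le_rfl
  intro I hI
  induction I, hI using Submodule.fg_induction with
  | sup I J hI hJ hI' hJ' =>
    intro hIJ
    rw [IsLocalization.coeSubmodule_sup]
    have h1 := le_sup_left.trans hIJ
    have h2 := le_sup_right.trans hIJ
    exact Submodule.exists_mul_sup_pow_le (IsLocalization.coeSubmodule_mono _ h1)
      (IsLocalization.coeSubmodule_mono _ h2) (hI' h1) (hJ' h2)
  | singleton a =>
    intro ha
    replace ha : a ∈ T := ha (Submodule.mem_span_singleton_self a)
    obtain ⟨s, rfl⟩ := hN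
    let P (k : ℕ) (n : A) : Prop := a ^ k • n ∈ IsLocalization.coeSubmodule A T ^ k
    have hmono {k l : ℕ} (hkl : k ≤ l) {n : A} (hk : P k n) : P l n := by
      obtain ⟨d, rfl⟩ := Nat.exists_eq_add_of_le hkl
      have : a ^ (k + d) • n = (a ^ k • n) * algebraMap R A a ^ d := by
        simp only [Algebra.smul_def, map_pow]; ring
      change a ^ (k + d) • n ∈ IsLocalization.coeSubmodule A T ^ (k + d)
      rw [this, pow_add]
      exact Submodule.mul_mem_mul hk (Submodule.pow_mem_pow _
        ((IsLocalization.mem_coeSubmodule _ _).2 ⟨a, ha, rfl⟩) d)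
    have hex (n : A) (hn : n ∈ s) : ∃ k, P k n := by
      obtain ⟨k, x, hx, hxn⟩ := h n (Submodule.subset_span hn) a ha
      refine ⟨k, ?_⟩
      change a ^ k • n ∈ IsLocalization.coeSubmodule A T ^ k
      rw [hxn, ← IsLocalization.coeSubmodule_pow]
      exact (IsLocalization.mem_coeSubmodule _ _).2 ⟨x, hx, rfl⟩
    choose! k hk using hex
    refine ⟨s.sup k, ?_⟩
    rw [← Ideal.span, IsLocalization.coeSubmodule_span_singleton, Submodule.span_pow,
      Set.singleton_pow, Submodule.span_mul_span, Submodule.span_le]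
    rintro _ ⟨n, hn, _, rfl, rfl⟩
    have := hmono (Finset.le_sup hn) (hk n hn)
    simpa [P, Algebra.smul_def, mul_comm] using this

/-- The multiplier ring `(J : J)` works: multiplication by `t ∈ J` embeds it into the Noetherian
module `J`. -/
theorem exists_finite_subalgebra_of_mul_le [IsNoetherianRing R] {N : Submodule R A} {J : Ideal R}
    (h : N * IsLocalization.coeSubmodule A J ≤ IsLocalization.coeSubmodule A J) {t : R} (ht : t ∈ J)
    (hreg : IsSMulRegular A t) :
    ∃ B : Subalgebra R A, Module.Finite R B ∧ N ≤ Subalgebra.toSubmodule B := by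
  let j := IsLocalization.coeSubmodule A J
  let B : Subalgebra R A :=
    { carrier := {b | ∀ y ∈ j, b * y ∈ j}
      mul_mem' {a b} ha hb y hy := by rw [mul_assoc]; exact ha _ (hb _ hy)
      add_mem' {a b} ha hb y hy := by rw [add_mul]; exact add_mem (ha _ hy) (hb _ hy)
      algebraMap_mem' r y hy := by rw [← Algebra.smul_def]; exact j.smul_mem r hy }
  have hfg : j.FG := (IsNoetherian.noetherian J).map _
  have : IsNoetherian R j := isNoetherian_of_fg_of_noetherian _ hfg
  let g : B →ₗ[R] j := ((LinearMap.lsmul R A t).comp B.val.toLinearMap).codRestrict j fun b => by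
    have := b.2 _ ((IsLocalization.mem_coeSubmodule A J).2 ⟨t, ht, rfl⟩)
    simpa [Algebra.smul_def, mul_comm] using this
  refine ⟨B, Module.Finite.of_injective g fun x y hxy => ?_, fun n hn y hy =>
    h (Submodule.mul_mem_mul hn hy)⟩
  exact Subtype.ext (hreg (congr_arg Subtype.val hxy))

theorem exists_ideal_of_finite_subalgebra [IsNoetherianRing R] {N : Submodule R A} {t : R}
    (htN : ∀ x ∈ N, t • x ∈ (1 : Submodule R A)) {B : Subalgebra R A} [Module.Finite R B]
    (hB : N ≤ Subalgebra.toSubmodule B) :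
    ∃ T : Ideal R, (∃ k, t ^ k ∈ T) ∧ ∀ n ∈ N, ∀ a ∈ T, ∃ x ∈ T, a • n = algebraMap R A x := by
  let D := Algebra.adjoin R (N : Set A)
  have hpow (b : A) (hb : b ∈ D) : ∃ k, t ^ k • b ∈ (1 : Submodule R A) := by
    induction hb using Algebra.adjoin_induction with
    | mem x hx => exact ⟨1, by simpa using htN x hx⟩
    | algebraMap r => exact ⟨0, by simp⟩
    | add x y _ _ hx hy =>
      obtain ⟨k, hk⟩ := hx
      obtain ⟨l, hl⟩ := hy
      refine ⟨k + l, ?_⟩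
      rw [smul_add]
      refine add_mem ?_ ?_
      · rw [add_comm, pow_add, mul_smul]; exact Submodule.smul_mem _ _ hk
      · rw [pow_add, mul_smul]; exact Submodule.smul_mem _ _ hl
    | mul x y _ _ hx hy =>
      obtain ⟨k, hk⟩ := hx
      obtain ⟨l, hl⟩ := hy
      refine ⟨k + l, ?_⟩
      rw [pow_add, ← smul_mul_smul_comm]
      simpa using Submodule.mul_mem_mul hk hl
  have hDB : Subalgebra.toSubmodule D ≤ Subalgebra.toSubmodule B := Algebra.adjoin_le hB
  have hBn : IsNoetherian R (Subalgebra.toSubmodule B) :=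
    isNoetherian_of_isNoetherianRing_of_finite R B
  obtain ⟨s, hs⟩ : (Subalgebra.toSubmodule D).FG :=
    (isNoetherian_submodule.1 hBn) _ hDB
  choose! k hk using hpow
  -- The conductor of `D` into `R`. Quantifying over the whole ring `D`, not just `N`, makes it
  -- stable under multiplication by `N`.
  let T : Ideal R :=
    { carrier := {r | ∀ b ∈ D, r • b ∈ (1 : Submodule R A)}
      zero_mem' b _ := by rw [zero_smul]; exact zero_mem _
      add_mem' {x y} hx hy b hb := by rw [add_smul]; exact add_mem (hx b hb) (hy b hb)
      smul_mem' r x hx b hb := by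
        rw [smul_eq_mul, mul_smul]; exact Submodule.smul_mem _ _ (hx b hb) }
  refine ⟨T, ⟨s.sup k, ?_⟩, fun n hn a ha => ?_⟩
  -- Each element of `D` is cleared by some power of `t`; finitely many generators of `D` need only
  -- one.
  · suffices H : Subalgebra.toSubmodule D ≤
        (1 : Submodule R A).comap (LinearMap.lsmul R A (t ^ s.sup k)) from
      fun (b : A) (hb : b ∈ Subalgebra.toSubmodule D) => H hb
    rw [← hs, Submodule.span_le]
    intro b hb
    replace hb : b ∈ s := hb
    have hbD : b ∈ D := by
      rw [← Subalgebra.mem_toSubmodule, ← hs]; exact Submodule.subset_span (Finset.mem_coe.2 hb)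
    obtain ⟨d, hd⟩ := Nat.exists_eq_add_of_le (Finset.le_sup (f := k) hb)
    have : t ^ s.sup k • b = t ^ d • t ^ k b • b := by rw [hd, add_comm, pow_add, mul_smul]
    change t ^ s.sup k • b ∈ (1 : Submodule R A)
    rw [this]
    exact Submodule.smul_mem _ _ (hk b hbD)
  · have hnD : n ∈ D := Algebra.subset_adjoin hn
    obtain ⟨x, hx⟩ := Submodule.mem_one.1 (ha n hnD)
    refine ⟨x, fun b hb => ?_, hx.symm⟩
    have := ha (n * b) (mul_mem hnD hb)
    rwa [← smul_mul_assoc, ← hx, ← Algebra.smul_def] at this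

end

end

theorem mainTheorem5 {R A : Type u} [CommRing R] [IsNoetherianRing R] [CommRing A] [Algebra R A]
    (S : Submonoid R) [IsLocalization S A] (hinj : Function.Injective (algebraMap R A))
    (N : Submodule R A) (hfg : N.FG) (hN : (1 : Submodule R A) ≤ N)
    (t : R) (ht : t ∈ nonZeroDivisors R) (htN : ∀ x ∈ N, t • x ∈ (1 : Submodule R A)) :
    IsIntegralExtension (PrimeSpectrum.zeroLocus {t}) (1 : Submodule R A) N ↔
      ∃ B : Subalgebra R A, Module.Finite R B ∧ N ≤ Subalgebra.toSubmodule B := by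
  constructor
  · rintro ⟨-, T, hT, hTt, heq⟩
    obtain ⟨k, hk⟩ := exists_mul_coeSubmodule_pow_le hfg hT fun n hn a ha =>
      exists_pow_smul_eq_of_inverseImage_blowUp_le_one heq.ge hn ha
    -- The multiplier ring is taken for `J = Tᵏ`; if `t^q ∈ T`, then `t^(qk) ∈ J`.
    rw [← IsLocalization.coeSubmodule_pow] at hk
    have htT : t ∈ T.radical := by
      rw [← PrimeSpectrum.vanishingIdeal_zeroLocus_eq_radical]
      exact (PrimeSpectrum.mem_vanishingIdeal _ _).2 fun x hx => hTt hx rfl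
    obtain ⟨q, hq⟩ := htT
    have hreg : IsSMulRegular A (t ^ (q * k)) := by
      intro x y hxy
      have h1 : algebraMap R A (t ^ (q * k)) ∈ nonZeroDivisors A :=
        IsLocalization.map_nonZeroDivisors_le S A ⟨_, pow_mem ht _, rfl⟩
      simp only [Algebra.smul_def] at hxy
      exact (mul_cancel_left_mem_nonZeroDivisors h1).1 hxy
    exact exists_finite_subalgebra_of_mul_le hk (pow_mul t q k ▸ Ideal.pow_mem_pow hq k) hreg
  · rintro ⟨B, hB, hNB⟩
    obtain ⟨T, ⟨k, hk⟩, hT⟩ := exists_ideal_of_finite_subalgebra htN hNB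
    refine ⟨hN, T, IsNoetherian.noetherian T, fun x hx => ?_,
      le_antisymm (inverseImage_mono hN) (inverseImage_blowUp_le_one S hinj hT)⟩
    rw [PrimeSpectrum.mem_zeroLocus, Set.singleton_subset_iff]
    exact x.2.mem_of_pow_mem k (hx hk)
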